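/- Let $\mu$ be a positive Borel measure on $\mathbb R$ that is finite on compact sets and has no atoms, with $\mu([0,\ell))>0$ for every $\ell>0$, and let $\mathfrak a:[0,\infty)\to\mathbb C$ be $\mu$-measurable with $|\mathfrak a|\le 1$ $\mu$-a.e. Put $$j=\begin{pmatrix}-1&0\\0&1\end{pmatrix},\qquad A=\begin{pmatrix}1&-\overline{\mathfrak a}\\-\mathfrak a&1\end{pmatrix},\qquad B=\begin{pmatrix}0&\overline{\mathfrak a}\\-\mathfrak a&0\end{pmatrix},$$ and let $\mathfrak A(z,\ell)$ be the transfer matrix of the canonical system in Arov gauge (A-gauge) with parameters $(\mu,\mathfrak a)$, i.e. the solution of $$\mathfrak A(z,\ell)\,j=j+\int_0^\ell \mathfrak A(z,l)\bigl(izA(l)-B(l)\bigr)\,d\mu(l),\qquad z\in\mathbb C,\ \ell\ge 0.$$ For $\operatorname{Im} z>0$ let $D(z,\ell)=\{w\in\mathbb C:\ (w\ \ 1)\,\mathfrak A(z,\ell)\,j\,\mathfrak A(z,\ell)^*\,(w\ \ 1)^*\ge 0\}$ be the Weyl disks. Assume that the system is in the limit point case, i.e. for every $z$ with $\operatorname{Im}z>0$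 the intersection $\bigcap_{\ell>0}D(z,\ell)$ consists of a single point, and let $s_+$ be the Schur function, defined by $\{s_+(z)\}=\bigcap_{\ell>0}D(z,\ell)$. If there is $\mathfrak a(0)\in\mathbb C$ such that $$\lim_{\ell\downarrow 0}\frac1{\mu([0,\ell))}\int_0^\ell|\mathfrak a(l)-\mathfrak a(0)|\,d\mu(l)=0,$$ then for every $\delta>0$ $$\lim_{\substack{z\to\infty\\ \arg z\in[\delta,\pi-\delta]}}s_+(z)=\frac{\mathfrak a(0)}{1+\sqrt{1-|\mathfrak a(0)|^2}}.$$ -/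

import Mathlib

open MeasureTheory Filter Topology Set
open scoped Matrix

noncomputable section

namespace ArovGauge

/-- The signature matrix `j = diag(-1, 1)`. -/
def jMat : Matrix (Fin 2) (Fin 2) ℂ := !![-1, 0; 0, 1]

/-- The coefficient `A ≥ 0` of an A-gauge system at a point where the parameter has value `a`. -/
def coeffA (a : ℂ) : Matrix (Fin 2) (Fin 2) ℂ := !![1, -star a; -a, 1]

/-- The skew-Hermitian coefficient `B` of an A-gauge system at a point where the parameter
has value `a`. -/
def coeffB (a : ℂ) : Matrix (Fin 2) (Fin 2) ℂ := !![0, star a; -a, 0]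

/-- `(μ, a)` are parameters of a canonical system in A-gauge on `[0, ∞)`: the positive measure `μ`
is finite on compact sets and has no atoms, and `a ∈ L^∞(μ)` with norm at most `1`. -/
structure IsParameters (μ : Measure ℝ) (a : ℝ → ℂ) : Prop where
  finite_on_compacts : ∀ K : Set ℝ, IsCompact K → μ K < ⊤
  no_atoms : ∀ x : ℝ, μ {x} = 0
  measurable : AEStronglyMeasurable a (μ.restrict (Ici 0))
  norm_le_one : ∀ᵐ l ∂(μ.restrict (Ici 0)), ‖a l‖ ≤ 1

/-- `𝔄` is the transfer matrix of the canonical system with parameters `(μ, a)`: for all `z ∈ ℂ` and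
`ℓ ≥ 0`, `𝔄(z,ℓ) j = j + ∫₀^ℓ 𝔄(z,l) (i z A(l) - B(l)) dμ(l)`, read entry by entry,
the integrand being integrable. -/
def IsTransferMatrix (μ : Measure ℝ) (a : ℝ → ℂ) (𝔄 : ℂ → ℝ → Matrix (Fin 2) (Fin 2) ℂ) : Prop :=
  ∀ (z : ℂ) (ℓ : ℝ), 0 ≤ ℓ → ∀ p q : Fin 2,
    IntervalIntegrable
      (fun l => (𝔄 z l * ((Complex.I * z) • coeffA (a l) - coeffB (a l))) p q) μ 0 ℓ ∧
    (𝔄 z ℓ * jMat) p q = jMat p q +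
      ∫ l in (0 : ℝ)..ℓ, (𝔄 z l * ((Complex.I * z) • coeffA (a l) - coeffB (a l))) p q ∂μ

/-- The Weyl disk `{w | (w 1) T j T* (w 1)* ≥ 0}` of a matrix `T`. The matrix `T j T*` is Hermitian,
so the quadratic form is real. -/
def weylDisk (T : Matrix (Fin 2) (Fin 2) ℂ) : Set ℂ :=
  {w | 0 ≤ ((![w, 1] ᵥ* (T * jMat * Tᴴ)) ⬝ᵥ star ![w, 1]).re}

/-- The family `𝔄` is in the limit point case and `s` is its Schur function `s₊` on the upper
half-plane: `{s₊(z)} = ⋂_{ℓ > 0} D(z,ℓ)`. -/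
def IsSchurFunction (𝔄 : ℂ → ℝ → Matrix (Fin 2) (Fin 2) ℂ) (s : ℂ → ℂ) : Prop :=
  ∀ z : ℂ, 0 < z.im → ⋂ ℓ ∈ Ioi (0 : ℝ), weylDisk (𝔄 z ℓ) = {s z}

end ArovGauge

end

namespace ArovGauge

/-! The argument is a blow-up at `ℓ = 0`. For large `z` in the sector, choose `L` with `‖z‖ * cumul
μ L = C`, where `C` is fixed. The row `(w, 1) 𝔄(z, ·)` with `w = s z` starts at `(w, 1)`, and in the
rescaled time `x = z * cumul μ ℓ` it is a perturbation of the system with constant coefficient `a₀`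
and no `B` term: the error up to `L` has size `‖z‖ ∫ ‖a - a₀‖ + cumul μ L`, small by the Lebesgue
point condition and because `cumul μ L = C / ‖z‖`. Grönwall turns this into closeness of the
solutions (`norm_sub_model_le`).

Membership in the Weyl disk at `L` says that the first entry of the row is dominated by the second,
so the model solution almost has this property at complex time `x` with `‖x‖ = C` and `x.im ≥ C sin
δ`. The model is explicit: unless `w` is near the fixed point `a₀ / (1 + κ)`, `κ = √(1 - ‖a₀‖²)`, a
growing mode destroys the domination (`exists_model_weyl`). Growth is exponential if `κ > 0` and
polynomial if `κ = 0`, hence two cases. -/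

/-- The signed distribution function `ℓ ↦ ∫₀^ℓ dμ` of a measure on the line. -/
noncomputable def cumul (μ : Measure ℝ) (ℓ : ℝ) : ℝ := ∫ _ in (0 : ℝ)..ℓ, (1 : ℝ) ∂μ

/-! ### Time change by the distribution function, and Grönwall's inequality -/

section Cumul

variable {μ : Measure ℝ}

@[simp] lemma cumul_zero : cumul μ 0 = 0 := by simp [cumul]

lemma cumul_eq_real {ℓ : ℝ} (h : 0 ≤ ℓ) : cumul μ ℓ = μ.real (Ioc 0 ℓ) := by
  simp [cumul, intervalIntegral.integral_of_le h]

lemma cumul_eq_real_Ico [NullSingletonClass μ] {ℓ : ℝ} (h : 0 ≤ ℓ) : cumul μ ℓ = μ.real (Ico 0 ℓ) := by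
  rw [cumul_eq_real h, measureReal_congr Ico_ae_eq_Ioc]

variable [IsLocallyFiniteMeasure μ]

lemma cumul_monotone : Monotone (cumul μ) := by
  intro x y hxy
  have h : cumul μ y - cumul μ x = μ.real (Ioc x y) := by
    unfold cumul
    rw [intervalIntegral.integral_interval_sub_left intervalIntegrable_const
      intervalIntegrable_const, intervalIntegral.integral_of_le hxy]
    simp
  linarith [measureReal_nonneg (μ := μ) (s := Ioc x y)]

lemma cumul_nonneg {ℓ : ℝ} (h : 0 ≤ ℓ) : 0 ≤ cumul μ ℓ := by
  simpa using cumul_monotone (μ := μ) h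

variable [NullSingletonClass μ]

lemma continuous_cumul : Continuous (cumul μ) :=
  intervalIntegral.continuous_primitive (fun _ _ => intervalIntegrable_const) 0

/-- The distribution function of an atomless measure pushes the measure forward to Lebesgue
measure. -/
lemma map_cumul_restrict {ℓ : ℝ} (hℓ : 0 ≤ ℓ) :
    (μ.restrict (Ioc 0 ℓ)).map (cumul μ) = volume.restrict (Ioc 0 (cumul μ ℓ)) := by
  have hcont := continuous_cumul (μ := μ)
  have : IsFiniteMeasure (μ.restrict (Ioc 0 ℓ)) :=
    ⟨by simpa using measure_Ioc_lt_top⟩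
  refine Measure.ext_of_Iic _ _ fun t => ?_
  rw [Measure.map_apply hcont.measurable measurableSet_Iic,
    Measure.restrict_apply (hcont.measurable measurableSet_Iic),
    Measure.restrict_apply measurableSet_Iic, inter_comm (Iic t), Ioc_inter_Iic, Real.volume_Ioc,
    sub_zero]
  rcases lt_or_ge t 0 with ht | ht
  · rw [ENNReal.ofReal_of_nonpos ((min_le_right _ _).trans ht.le)]
    convert measure_empty (μ := μ)
    ext x
    simp only [mem_inter_iff, mem_preimage, mem_Iic, mem_Ioc, mem_empty_iff_false, iff_false]
    rintro ⟨h1, h2, -⟩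
    linarith [cumul_nonneg (μ := μ) h2.le]
  -- `cumul μ` may have plateaus, so it need not be injective; taking the last point of the sublevel
  -- set makes the preimage exactly `Ioc 0 x`.
  · obtain ⟨x, ⟨⟨hx0, hxℓ⟩, hxt⟩, hmax⟩ :=
      (isCompact_Icc.inter_right (isClosed_Iic.preimage hcont) :
        IsCompact (Icc 0 ℓ ∩ cumul μ ⁻¹' Iic t)).exists_isGreatest ⟨0, by simp [hℓ, ht]⟩
    have hset : cumul μ ⁻¹' Iic t ∩ Ioc 0 ℓ = Ioc 0 x := by
      ext y
      constructor
      · rintro ⟨h1, h2⟩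
        exact ⟨h2.1, hmax ⟨⟨h2.1.le, h2.2⟩, h1⟩⟩
      · rintro ⟨h1, h2⟩
        exact ⟨(cumul_monotone h2).trans hxt, h1, h2.trans hxℓ⟩
    have hval : cumul μ x = min (cumul μ ℓ) t := by
      refine le_antisymm (le_min (cumul_monotone hxℓ) hxt) ?_
      by_contra! hlt
      obtain ⟨y, ⟨hy1, hy2⟩, hy⟩ := intermediate_value_Icc hxℓ hcont.continuousOn
        ⟨hlt.le, min_le_left (cumul μ ℓ) t⟩
      have : y ≤ x := hmax ⟨⟨hx0.trans hy1, hy2⟩, hy.le.trans (min_le_right _ _)⟩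
      have hyx : y = x := le_antisymm this hy1
      rw [hyx] at hy
      exact hlt.ne hy
    rw [hset, ← hval, cumul_eq_real hx0, ofReal_measureReal measure_Ioc_lt_top.ne]

/-- The fundamental theorem of calculus along the distribution function of an atomless measure. -/
lemma integral_comp_cumul {E : Type*} [NormedAddCommGroup E] [NormedSpace ℝ E] [CompleteSpace E]
    {F φ : ℝ → E} (hF : ∀ t, HasDerivAt F (φ t) t)
    (hφ : Continuous φ) {ℓ : ℝ} (hℓ : 0 ≤ ℓ) :
    ∫ l in (0 : ℝ)..ℓ, φ (cumul μ l) ∂μ = F (cumul μ ℓ) - F 0 := by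
  rw [intervalIntegral.integral_of_le hℓ,
    ← intervalIntegral.integral_eq_sub_of_hasDerivAt (fun t _ => hF t)
      (hφ.intervalIntegrable _ _),
    intervalIntegral.integral_of_le (cumul_nonneg hℓ), ← map_cumul_restrict hℓ,
    integral_map continuous_cumul.aemeasurable hφ.aestronglyMeasurable]

/-- A Grönwall inequality with respect to an atomless measure. -/
lemma le_exp_of_le_add_integral {u : ℝ → ℝ} {c K L : ℝ} (hL : 0 ≤ L) (hc : 0 ≤ c) (hK : 0 < K)
    (hu : ContinuousOn u (Icc 0 L))
    (h : ∀ ℓ ∈ Icc 0 L, u ℓ ≤ c + K * ∫ l in (0 : ℝ)..ℓ, u l ∂μ) :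
    u L ≤ 2 * c * Real.exp (2 * K * cumul μ L) := by
  have hcont := continuous_cumul (μ := μ)
  have hwc : Continuous fun l => Real.exp (2 * K * cumul μ l) := by fun_prop
  -- Weighted maximum argument instead of iteration: with the exponent `2 * K`, integrating the
  -- bound costs a factor `1 / (2 * K)`, so at the maximum point the integral term absorbs only half
  -- of `M`.
  obtain ⟨x, hx, hmax⟩ := isCompact_Icc.exists_isMaxOn (nonempty_Icc.2 hL)
    (hu.mul (f := u) (g := fun l => Real.exp (-(2 * K * cumul μ l))) (by fun_prop))
  set M := u x * Real.exp (-(2 * K * cumul μ x)) with hM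
  have hle : ∀ l ∈ Icc 0 L, u l ≤ M * Real.exp (2 * K * cumul μ l) := by
    intro l hl
    have h1 : u l * Real.exp (-(2 * K * cumul μ l)) ≤ M := hmax hl
    rwa [Real.exp_neg, ← div_eq_mul_inv, div_le_iff₀ (Real.exp_pos _)] at h1
  have hux : u x = M * Real.exp (2 * K * cumul μ x) := by
    rw [hM, mul_assoc, ← Real.exp_add]; simp
  have hint : ∫ l in (0 : ℝ)..x, u l ∂μ ≤ M * ((Real.exp (2 * K * cumul μ x) - 1) / (2 * K)) := by
    have h1 : ∫ l in (0 : ℝ)..x, u l ∂μ ≤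
        ∫ l in (0 : ℝ)..x, M * Real.exp (2 * K * cumul μ l) ∂μ := by
      refine intervalIntegral.integral_mono_on hx.1 ?_
        ((hwc.const_mul M).intervalIntegrable _ _) fun l hl => hle l ⟨hl.1, hl.2.trans hx.2⟩
      refine ContinuousOn.intervalIntegrable (hu.mono ?_)
      rw [uIcc_of_le hx.1]
      exact Icc_subset_Icc_right hx.2
    refine h1.trans_eq ?_
    rw [intervalIntegral.integral_const_mul,
      integral_comp_cumul (F := fun t => Real.exp (2 * K * t) / (2 * K))
        (φ := fun t => Real.exp (2 * K * t)) _ (by fun_prop) hx.1]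
    · simp; left; ring
    · intro t
      have := (((hasDerivAt_id t).const_mul (2 * K)).exp).div_const (2 * K)
      refine this.congr_deriv ?_
      simp only [id]
      field_simp
  have h1 := h x hx
  have h2 : K * ∫ l in (0 : ℝ)..x, u l ∂μ ≤ M * (Real.exp (2 * K * cumul μ x) - 1) / 2 := by
    calc _ ≤ K * (M * ((Real.exp (2 * K * cumul μ x) - 1) / (2 * K))) := by gcongr
      _ = _ := by field_simp
  have he : 1 ≤ Real.exp (2 * K * cumul μ x) :=
    Real.one_le_exp (by have := cumul_nonneg (μ := μ) hx.1; positivity)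
  have hMc : M ≤ 2 * c := by
    rcases le_or_gt M 0 with h0 | h0
    · linarith
    · nlinarith
  exact (hle L ⟨hL, le_rfl⟩).trans (by gcongr)

end Cumul

/-! ### The constant coefficient system -/

open Complex in
/-- The solution of `S'' = -κ² S` with `S 0 = 0` and `S' 0 = 1`. -/
noncomputable def sinDiv (κ x : ℂ) : ℂ := if κ = 0 then x else sin (κ * x) / κ

@[simp] lemma sinDiv_zero (κ : ℂ) : sinDiv κ 0 = 0 := by simp [sinDiv]

lemma mul_sinDiv (κ x : ℂ) : κ * sinDiv κ x = Complex.sin (κ * x) := by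
  unfold sinDiv
  split_ifs with h
  · simp [h]
  · field_simp

lemma hasDerivAt_sinDiv (κ x : ℂ) : HasDerivAt (sinDiv κ) (Complex.cos (κ * x)) x := by
  unfold sinDiv
  split_ifs with h
  · simpa [h] using hasDerivAt_id' x
  · have := (((hasDerivAt_id x).const_mul κ).csin).div_const κ
    refine this.congr_deriv ?_
    simp only [id, mul_one]
    field_simp

lemma hasDerivAt_cos_mul (κ x : ℂ) :
    HasDerivAt (fun x => Complex.cos (κ * x)) (-(κ ^ 2 * sinDiv κ x)) x := by
  have := ((hasDerivAt_id x).const_mul κ).ccos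
  refine this.congr_deriv ?_
  simp only [id, mul_one, sq, mul_assoc, mul_sinDiv]
  ring

lemma continuous_sinDiv (κ : ℂ) : Continuous (sinDiv κ) :=
  continuous_iff_continuousAt.2 fun x => (hasDerivAt_sinDiv κ x).continuousAt

/-- The first component of the solution of the constant coefficient system
`V' = V (i A j)` with `V 0 = (w, 1)`. -/
noncomputable def model₁ (κ a w x : ℂ) : ℂ :=
  w * Complex.cos (κ * x) + Complex.I * (a - w) * sinDiv κ x

/-- The second component of the solution of the constant coefficient system
`V' = V (i A j)` with `V 0 = (w, 1)`. -/
noncomputable def model₂ (κ a w x : ℂ) : ℂ :=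
  Complex.cos (κ * x) + Complex.I * (1 - star a * w) * sinDiv κ x

@[simp] lemma model₁_zero (κ a w : ℂ) : model₁ κ a w 0 = w := by simp [model₁]

@[simp] lemma model₂_zero (κ a w : ℂ) : model₂ κ a w 0 = 1 := by simp [model₂]

section Model

variable {κ a : ℂ}

lemma continuous_model₁ : Continuous fun p : ℂ × ℂ => model₁ κ a p.1 p.2 := by
  have := continuous_sinDiv κ
  unfold model₁
  fun_prop

lemma continuous_model₂ : Continuous fun p : ℂ × ℂ => model₂ κ a p.1 p.2 := by
  have := continuous_sinDiv κ
  unfold model₂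
  fun_prop

/-- Here `(A j)² = κ²` is scalar, so `exp(i x A j) = cos(κ x) + i A j sin(κ x) / κ`, with the
quotient read as `x` when `κ = 0`; the models are the entries of `(w, 1)` times this matrix. -/
lemma hasDerivAt_model₁ (h : κ ^ 2 = 1 - a * star a) (w x : ℂ) :
    HasDerivAt (model₁ κ a w)
      (Complex.I * (a * model₂ κ a w x - model₁ κ a w x)) x := by
  have := ((hasDerivAt_cos_mul κ x).const_mul w).add
    ((hasDerivAt_sinDiv κ x).const_mul (Complex.I * (a - w)))
  refine this.congr_deriv ?_
  unfold model₁ model₂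
  linear_combination (-w * sinDiv κ x) * h -
    w * (1 - a * star a) * sinDiv κ x * Complex.I_sq

lemma hasDerivAt_model₂ (h : κ ^ 2 = 1 - a * star a) (w x : ℂ) :
    HasDerivAt (model₂ κ a w)
      (Complex.I * (model₂ κ a w x - star a * model₁ κ a w x)) x := by
  have := (hasDerivAt_cos_mul κ x).add
    ((hasDerivAt_sinDiv κ x).const_mul (Complex.I * (1 - star a * w)))
  refine this.congr_deriv ?_
  unfold model₁ model₂
  linear_combination (-sinDiv κ x) * h -
    (1 - a * star a) * sinDiv κ x * Complex.I_sq

/-- Compactness; uniformity in `w` and `x` is needed because both will vary with `z`. -/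
lemma exists_model_bound (κ a : ℂ) (C : ℝ) : ∃ S : ℝ, 0 ≤ S ∧ ∀ w x : ℂ, ‖w‖ ≤ 1 → ‖x‖ ≤ C →
    ‖model₁ κ a w x‖ + ‖model₂ κ a w x‖ ≤ S := by
  obtain ⟨S, hS⟩ := ((isCompact_closedBall (0 : ℂ) 1).prod
    (isCompact_closedBall (0 : ℂ) C)).exists_bound_of_continuousOn
    (f := fun p : ℂ × ℂ => ‖model₁ κ a p.1 p.2‖ + ‖model₂ κ a p.1 p.2‖)
    (continuous_model₁.norm.add continuous_model₂.norm).continuousOn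
  refine ⟨max S 0, le_max_right _ _, fun w x hw hx => ?_⟩
  refine le_trans (le_trans (le_abs_self _) (hS (w, x) ?_)) (le_max_left _ _)
  simp [hw, hx]

end Model

/-- If the constant coefficient solution is close to the Weyl disk after a long time, then the
initial value is close to the attracting fixed point: the strictly contractive case. -/
lemma exists_model_weyl_of_pos {a : ℂ} {κ : ℝ} (ha : ‖a‖ ≤ 1) (hκ : 0 < κ)
    (h : (κ : ℂ) ^ 2 = 1 - a * star a) {c ε : ℝ} (hc : 0 < c) (hε : 0 < ε) :
    ∃ C > 0, ∃ ε' > 0, ∀ w x : ℂ, ‖w‖ ≤ 1 → ‖x‖ ≤ C → c * C ≤ x.im →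
      ‖model₁ κ a w x‖ ≤ ‖model₂ κ a w x‖ + ε' → ‖w - a / (1 + κ)‖ < ε := by
  have hκ1 : (1 + κ : ℂ) ≠ 0 := by
    exact_mod_cast (by positivity : (1 + κ : ℝ) ≠ 0)
  have hk1 : κ ≤ 1 := by
    have : κ ^ 2 = 1 - ‖a‖ ^ 2 := by
      have h2 : a * star a = ((‖a‖ ^ 2 : ℝ) : ℂ) := by
        rw [Complex.star_def, Complex.mul_conj, Complex.normSq_eq_norm_sq]
      rw [h2] at h
      exact_mod_cast h
    nlinarith [sq_nonneg ‖a‖]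
  have hlim : Tendsto (fun C : ℝ => Real.exp (-(κ * c * C)) * (2 * 4 / κ + 1)) atTop (𝓝 0) := by
    have h1 : Tendsto (fun C : ℝ => κ * c * C) atTop atTop :=
      tendsto_id.const_mul_atTop (by positivity)
    simpa using (Real.tendsto_exp_neg_atTop_nhds_zero.comp h1).mul_const (2 * 4 / κ + 1)
  obtain ⟨C, hC0, hC⟩ := ((eventually_gt_atTop 0).and (hlim.eventually_lt_const hε)).exists
  refine ⟨C, hC0, 1, one_pos, fun w x hw _ hx hV => lt_of_le_of_lt ?_ hC⟩
  set σ := a / (1 + κ) with hσ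
  have hσa : star a * σ = 1 - κ := by
    rw [hσ]; field_simp; linear_combination h
  have hσκ : a = (1 + κ) * σ := by rw [hσ]; field_simp
  have hσ1 : ‖σ‖ ≤ 1 := by
    have h1 : ‖a‖ = (1 + κ) * ‖σ‖ := by
      conv_lhs => rw [hσκ]
      rw [norm_mul]
      congr 1
      rw [show (1 + κ : ℂ) = ((1 + κ : ℝ) : ℂ) by push_cast; rfl, Complex.norm_real,
        Real.norm_of_nonneg (by positivity)]
    nlinarith [norm_nonneg σ]
  set V₁ := model₁ κ a w x with hV₁
  set V₂ := model₂ κ a w x with hV₂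
  -- The two eigenmodes: this one has modulus growing like `exp(κ x.im)`, while the combination in
  -- `hg` does not grow.
  have hf : V₁ - σ * V₂ = (w - σ) * Complex.exp (-(κ * x) * Complex.I) := by
    rw [Complex.exp_mul_I, Complex.cos_neg, Complex.sin_neg, ← mul_sinDiv, hV₁, hV₂]
    unfold model₁ model₂
    linear_combination (Complex.I * sinDiv κ x) * hσκ + (Complex.I * sinDiv κ x * w) * hσa
  have hg : (1 + κ) * V₂ - star a * V₁ =
      ((1 + κ) - star a * w) * Complex.exp ((κ * x) * Complex.I) := by
    rw [Complex.exp_mul_I, ← mul_sinDiv, hV₁, hV₂]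
    unfold model₁ model₂
    linear_combination (-Complex.I * sinDiv κ x) * h
  have hef : ‖Complex.exp (-(κ * x) * Complex.I)‖ = Real.exp (κ * x.im) := by
    rw [Complex.norm_exp]; simp
  have heg : ‖Complex.exp ((κ * x) * Complex.I)‖ ≤ 1 := by
    rw [Complex.norm_exp]
    have : 0 ≤ κ * x.im := mul_nonneg hκ.le (le_trans (by positivity) hx)
    simpa using this
  have hκn : ‖(1 + κ : ℂ)‖ = 1 + κ := by
    rw [show (1 + κ : ℂ) = ((1 + κ : ℝ) : ℂ) by push_cast; rfl, Complex.norm_real,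
        Real.norm_of_nonneg (by positivity)]
  have hgle : ‖(1 + κ) * V₂ - star a * V₁‖ ≤ 3 := by
    rw [hg, norm_mul]
    have h1 : ‖(1 + κ : ℂ) - star a * w‖ ≤ 3 := by
      refine (norm_sub_le _ _).trans ?_
      rw [hκn, norm_mul, norm_star]
      nlinarith [norm_nonneg a, norm_nonneg w]
    nlinarith [norm_nonneg ((1 + κ : ℂ) - star a * w)]
  have hgge : (1 + κ) * ‖V₂‖ - ‖V₁‖ ≤ ‖(1 + κ) * V₂ - star a * V₁‖ := by
    refine le_trans ?_ (norm_sub_norm_le _ _)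
    rw [norm_mul, norm_mul, hκn, norm_star]
    nlinarith [norm_nonneg V₁]
  -- The non-growing mode and `‖V₁‖ ≤ ‖V₂‖ + 1` give `κ ‖V₂‖ ≤ 3 + 1`. So the growing mode is
  -- bounded too, which forces `w - σ` to be exponentially small.
  have hV2 : ‖V₂‖ ≤ 4 / κ := by
    rw [le_div_iff₀ hκ]; linarith
  have hfle : ‖V₁ - σ * V₂‖ ≤ 2 * 4 / κ + 1 := by
    refine (norm_sub_le _ _).trans ?_
    rw [norm_mul]
    have : ‖σ‖ * ‖V₂‖ ≤ ‖V₂‖ := mul_le_of_le_one_left (norm_nonneg _) hσ1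
    have : 2 * 4 / κ = 4 / κ + 4 / κ := by ring
    linarith
  rw [hf, norm_mul, hef] at hfle
  have hexp : Real.exp (κ * c * C) ≤ Real.exp (κ * x.im) := by
    rw [Real.exp_le_exp, mul_assoc]; gcongr
  rw [Real.exp_neg, inv_mul_eq_div, le_div_iff₀ (Real.exp_pos _)]
  exact (mul_le_mul_of_nonneg_left hexp (norm_nonneg _)).trans hfle

/-- If the constant coefficient solution is close to the Weyl disk after a long time, then the
initial value is close to the fixed point: the unimodular case. -/
lemma exists_model_weyl_of_norm_eq_one {a : ℂ} (ha : a * star a = 1) {c ε : ℝ} (hc : 0 < c)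
    (hε : 0 < ε) :
    ∃ C > 0, ∃ ε' > 0, ∀ w x : ℂ, ‖w‖ ≤ 1 → ‖x‖ ≤ C → c * C ≤ x.im →
      ‖model₁ 0 a w x‖ ≤ ‖model₂ 0 a w x‖ + ε' → ‖w - a‖ < ε := by
  have hlim : Tendsto (fun C : ℝ => 5 / (2 * c * C)) atTop (𝓝 0) :=
    tendsto_const_nhds.div_atTop (tendsto_id.const_mul_atTop (by positivity))
  obtain ⟨C, hC0, hC⟩ :=
    ((eventually_gt_atTop 0).and (hlim.eventually_lt_const (sq_pos_of_pos hε))).exists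
  have hna : ‖a‖ = 1 := by
    have : ‖a‖ * ‖a‖ = 1 := by
      simpa using congrArg norm ha
    nlinarith [norm_nonneg a]
  -- As `‖V₂‖ ≤ 1 + 2 * C`, this tolerance costs at most `1` after squaring. The identity `hexp`
  -- then gives `‖f‖² (1 + 2 x.im) ≤ 1 + 2 ‖f‖ ≤ 5`, the source of the constant `5`.
  refine ⟨C, hC0, 1 / (3 + 4 * C), by positivity, fun w x hw hxC hx hV => ?_⟩
  refine lt_of_pow_lt_pow_left₀ 2 hε.le (lt_of_le_of_lt ?_ hC)
  set f := w - a with hf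
  have hf2 : ‖f‖ ≤ 2 := (norm_sub_le _ _).trans (by linarith)
  have h2 : model₂ 0 a w x = 1 - Complex.I * star a * f * x := by
    simp only [model₂, sinDiv, if_true, zero_mul, Complex.cos_zero]
    linear_combination (-Complex.I * x) * ha
  have h1 : model₁ 0 a w x = f + a * model₂ 0 a w x := by
    rw [h2]
    simp only [model₁, sinDiv, if_true, zero_mul, Complex.cos_zero]
    linear_combination (Complex.I * f * x) * ha
  set V₁ := model₁ 0 a w x
  set V₂ := model₂ 0 a w x
  have hV2 : ‖V₂‖ ≤ 1 + 2 * C := by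
    rw [h2]
    refine (norm_sub_le _ _).trans ?_
    simp only [norm_mul, norm_star, hna, Complex.norm_I, norm_one, one_mul]
    nlinarith [norm_nonneg f, norm_nonneg x]
  have hsq : ‖V₁‖ ^ 2 ≤ ‖V₂‖ ^ 2 + 1 := by
    have h3 : 1 / (3 + 4 * C) * (3 + 4 * C) = 1 := by field_simp
    have h4 : 0 < 1 / (3 + 4 * C) := by positivity
    set e := 1 / (3 + 4 * C)
    have h5 : e ≤ 1 := by nlinarith
    calc ‖V₁‖ ^ 2 ≤ (‖V₂‖ + e) ^ 2 := by gcongr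
      _ = ‖V₂‖ ^ 2 + e * (2 * ‖V₂‖ + e) := by ring
      _ ≤ ‖V₂‖ ^ 2 + e * (3 + 4 * C) := by gcongr ‖V₂‖ ^ 2 + e * ?_; linarith
      _ = _ := by linarith
  have hexp : ‖V₁‖ ^ 2 = ‖V₂‖ ^ 2 + ‖f‖ ^ 2 * (1 + 2 * x.im) + 2 * (f * star a).re := by
    have hstar : star V₁ = star f + star a * star V₂ := by rw [h1]; simp
    have hV2s : star V₂ = 1 + Complex.I * a * star f * star x := by rw [h2]; simp
    have key : V₁ * star V₁ = V₂ * star V₂ + f * star f * (1 + Complex.I * (star x - x))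
        + (f * star a + star (f * star a)) := by
      rw [hstar, h1, star_mul', star_star]
      have e1 : f * star a * star V₂ = f * star a + f * star f * Complex.I * star x := by
        rw [hV2s]; linear_combination (f * star f * Complex.I * star x) * ha
      have e2 : star f * a * V₂ = star f * a - f * star f * Complex.I * x := by
        rw [h2]; linear_combination (-f * star f * Complex.I * x) * ha
      linear_combination e1 + e2 + V₂ * star V₂ * ha
    have hx2 : 1 + Complex.I * (star x - x) = ((1 + 2 * x.im : ℝ) : ℂ) := by
      apply Complex.ext <;> simp; ring
    have hre : f * star a + star (f * star a) = ((2 * (f * star a).re : ℝ) : ℂ) := by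
      apply Complex.ext <;> simp [two_mul]; ring
    have hns : ∀ u : ℂ, u * star u = ((‖u‖ ^ 2 : ℝ) : ℂ) := fun u => by
      rw [Complex.star_def, Complex.mul_conj, Complex.normSq_eq_norm_sq]
    rw [hx2, hre, hns, hns, hns] at key
    exact_mod_cast key
  have hre : -‖f‖ ≤ (f * star a).re := by
    have := (abs_le.1 (Complex.abs_re_le_norm (f * star a))).1
    rwa [norm_mul, norm_star, hna, mul_one] at this
  rw [le_div_iff₀ (by positivity)]
  have : ‖f‖ ^ 2 * (2 * c * C) ≤ ‖f‖ ^ 2 * (1 + 2 * x.im) := by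
    gcongr; linarith
  linarith

/-- If the constant coefficient solution is close to the Weyl disk after a long time, then the
initial value is close to the fixed point. -/
lemma exists_model_weyl {a : ℂ} (ha : ‖a‖ ≤ 1) {c ε : ℝ} (hc : 0 < c) (hε : 0 < ε) :
    ∃ C > 0, ∃ ε' > 0, ∀ w x : ℂ, ‖w‖ ≤ 1 → ‖x‖ ≤ C → c * C ≤ x.im →
      ‖model₁ (Real.sqrt (1 - ‖a‖ ^ 2)) a w x‖ ≤
        ‖model₂ (Real.sqrt (1 - ‖a‖ ^ 2)) a w x‖ + ε' →
      ‖w - a / (1 + (Real.sqrt (1 - ‖a‖ ^ 2) : ℂ))‖ < ε := by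
  have h0 : 0 ≤ 1 - ‖a‖ ^ 2 := by nlinarith [norm_nonneg a]
  have hns : a * star a = ((‖a‖ ^ 2 : ℝ) : ℂ) := by
    rw [Complex.star_def, Complex.mul_conj, Complex.normSq_eq_norm_sq]
  rcases h0.eq_or_lt with h | h
  · have h1 : a * star a = 1 := by
      rw [hns, show ‖a‖ ^ 2 = 1 by linarith]; simp
    simpa [← h] using exists_model_weyl_of_norm_eq_one h1 hc hε
  · refine exists_model_weyl_of_pos ha (Real.sqrt_pos.2 h) ?_ hc hε
    rw [hns]
    exact_mod_cast Real.sq_sqrt h0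

/-! ### Comparison with the constant coefficient system -/

section Perturbation

variable {μ : Measure ℝ} [IsLocallyFiniteMeasure μ]

lemma intervalIntegrable_of_ae_norm_le {E : Type*} [NormedAddCommGroup E] {g : ℝ → E} {C : ℝ}
    (hg : AEStronglyMeasurable g (μ.restrict (Ici 0)))
    (hb : ∀ᵐ l ∂(μ.restrict (Ici 0)), ‖g l‖ ≤ C) {ℓ : ℝ} (hℓ : 0 ≤ ℓ) :
    IntervalIntegrable g μ 0 ℓ := by
  have hsub : Ioc 0 ℓ ⊆ Ici (0 : ℝ) := fun x hx => hx.1.le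
  rw [intervalIntegrable_iff_integrableOn_Ioc_of_le hℓ]
  have : IsFiniteMeasure (μ.restrict (Ioc 0 ℓ)) := ⟨by simpa using measure_Ioc_lt_top⟩
  exact Integrable.of_bound (hg.mono_set hsub) C
    (ae_restrict_of_ae_restrict_of_subset hsub hb)

variable [NullSingletonClass μ] {κ a₀ z w : ℂ}

lemma integral_model₁ (h : κ ^ 2 = 1 - a₀ * star a₀) {ℓ : ℝ} (hℓ : 0 ≤ ℓ) :
    model₁ κ a₀ w (z * cumul μ ℓ) = w + ∫ l in (0 : ℝ)..ℓ,
      Complex.I * (a₀ * model₂ κ a₀ w (z * cumul μ l) - model₁ κ a₀ w (z * cumul μ l)) * z ∂μ := by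
  have h1 := continuous_model₁ (κ := κ) (a := a₀)
  have h2 := continuous_model₂ (κ := κ) (a := a₀)
  have hd : ∀ t : ℝ, HasDerivAt (fun t : ℝ => model₁ κ a₀ w (z * t))
      (Complex.I * (a₀ * model₂ κ a₀ w (z * t) - model₁ κ a₀ w (z * t)) * z) t := fun t => by
    have h3 : HasDerivAt (fun t : ℝ => z * (t : ℂ)) z t := by
      simpa using (Complex.ofRealCLM.hasDerivAt (x := t)).const_mul z
    exact (hasDerivAt_model₁ h w (z * t)).comp t h3
  have hc : Continuous fun t : ℝ =>
      Complex.I * (a₀ * model₂ κ a₀ w (z * t) - model₁ κ a₀ w (z * t)) * z := by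
    have h3 := h1.comp (f := fun t : ℝ => (w, z * (t : ℂ))) (by fun_prop)
    have h4 := h2.comp (f := fun t : ℝ => (w, z * (t : ℂ))) (by fun_prop)
    exact (continuous_const.mul ((continuous_const.mul h4).sub h3)).mul continuous_const
  have := integral_comp_cumul (μ := μ) hd hc hℓ
  simp only [Complex.ofReal_zero, mul_zero, model₁_zero] at this
  rw [this]
  ring

lemma integral_model₂ (h : κ ^ 2 = 1 - a₀ * star a₀) {ℓ : ℝ} (hℓ : 0 ≤ ℓ) :
    model₂ κ a₀ w (z * cumul μ ℓ) = 1 + ∫ l in (0 : ℝ)..ℓ,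
      Complex.I * (model₂ κ a₀ w (z * cumul μ l) - star a₀ * model₁ κ a₀ w (z * cumul μ l)) * z
        ∂μ := by
  have h1 := continuous_model₁ (κ := κ) (a := a₀)
  have h2 := continuous_model₂ (κ := κ) (a := a₀)
  have hd : ∀ t : ℝ, HasDerivAt (fun t : ℝ => model₂ κ a₀ w (z * t))
      (Complex.I * (model₂ κ a₀ w (z * t) - star a₀ * model₁ κ a₀ w (z * t)) * z) t := fun t => by
    have h3 : HasDerivAt (fun t : ℝ => z * (t : ℂ)) z t := by
      simpa using (Complex.ofRealCLM.hasDerivAt (x := t)).const_mul z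
    exact (hasDerivAt_model₂ h w (z * t)).comp t h3
  have hc : Continuous fun t : ℝ =>
      Complex.I * (model₂ κ a₀ w (z * t) - star a₀ * model₁ κ a₀ w (z * t)) * z := by
    have h3 := h1.comp (f := fun t : ℝ => (w, z * (t : ℂ))) (by fun_prop)
    have h4 := h2.comp (f := fun t : ℝ => (w, z * (t : ℂ))) (by fun_prop)
    exact (continuous_const.mul (h4.sub (continuous_const.mul h3))).mul continuous_const
  have := integral_comp_cumul (μ := μ) hd hc hℓ
  simp only [Complex.ofReal_zero, mul_zero, model₂_zero] at this
  rw [this]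
  ring

/-- Comparison of a solution of the canonical system with that of the constant coefficient
system. -/
lemma norm_sub_model_le {a : ℝ → ℂ} (ham : AEStronglyMeasurable a (μ.restrict (Ici 0)))
    (hab : ∀ᵐ l ∂(μ.restrict (Ici 0)), ‖a l‖ ≤ 1) (h : κ ^ 2 = 1 - a₀ * star a₀)
    {v₁ v₂ : ℝ → ℂ} {L S : ℝ} (hL : 0 ≤ L)
    (hv₁ : ContinuousOn v₁ (Icc 0 L)) (hv₂ : ContinuousOn v₂ (Icc 0 L))
    (h₁ : ∀ ℓ ∈ Icc 0 L, v₁ ℓ = w + ∫ l in (0 : ℝ)..ℓ,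
      (-(Complex.I * z) * v₁ l + (Complex.I * z - 1) * (a l * v₂ l)) ∂μ)
    (h₂ : ∀ ℓ ∈ Icc 0 L, v₂ ℓ = 1 + ∫ l in (0 : ℝ)..ℓ,
      (Complex.I * z * v₂ l - (Complex.I * z + 1) * (star (a l) * v₁ l)) ∂μ)
    (hS : 0 ≤ S) (hV : ∀ l ∈ Icc 0 L,
      ‖model₁ κ a₀ w (z * cumul μ l)‖ + ‖model₂ κ a₀ w (z * cumul μ l)‖ ≤ S) :
    ‖v₁ L - model₁ κ a₀ w (z * cumul μ L)‖ + ‖v₂ L - model₂ κ a₀ w (z * cumul μ L)‖ ≤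
      2 * (S * (‖z‖ * (∫ l in (0 : ℝ)..L, ‖a l - a₀‖ ∂μ) + cumul μ L)) *
        Real.exp (2 * (2 * ‖z‖ + 1) * cumul μ L) := by
  have hcum := continuous_cumul (μ := μ)
  set V₁ : ℝ → ℂ := fun l => model₁ κ a₀ w (z * cumul μ l) with hV₁
  set V₂ : ℝ → ℂ := fun l => model₂ κ a₀ w (z * cumul μ l) with hV₂
  have hV₁c : Continuous V₁ := continuous_model₁.comp
    (f := fun l : ℝ => (w, z * (cumul μ l : ℂ))) (by fun_prop)
  have hV₂c : Continuous V₂ := continuous_model₂.comp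
    (f := fun l : ℝ => (w, z * (cumul μ l : ℂ))) (by fun_prop)
  have hIcc : ∀ {ℓ : ℝ}, ℓ ∈ Icc 0 L → uIcc 0 ℓ ⊆ Icc 0 L := fun {ℓ} hℓ => by
    rw [uIcc_of_le hℓ.1]; exact Icc_subset_Icc_right hℓ.2
  have hai : ∀ {ℓ : ℝ}, 0 ≤ ℓ → IntervalIntegrable a μ 0 ℓ :=
    fun hℓ => intervalIntegrable_of_ae_norm_le ham hab hℓ
  have hasi : ∀ {ℓ : ℝ}, 0 ≤ ℓ → IntervalIntegrable (fun l => star (a l)) μ 0 ℓ :=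
    fun hℓ => intervalIntegrable_of_ae_norm_le (C := 1)
      (continuous_star.comp_aestronglyMeasurable ham) (by simpa using hab) hℓ
  have hdi : ∀ {ℓ : ℝ}, 0 ≤ ℓ → IntervalIntegrable (fun l => ‖a l - a₀‖) μ 0 ℓ :=
    fun hℓ => ((hai hℓ).sub intervalIntegrable_const).norm
  have hab' : ∀ {ℓ : ℝ}, ∀ᵐ l ∂μ, l ∈ Ioc 0 ℓ → ‖a l‖ ≤ 1 := fun {ℓ} => by
    filter_upwards [(ae_restrict_iff' measurableSet_Ici).1 hab] with l hl hl'
    exact hl hl'.1.le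
  set u : ℝ → ℝ := fun l => ‖v₁ l - V₁ l‖ + ‖v₂ l - V₂ l‖ with hu
  have huc : ContinuousOn u (Icc 0 L) :=
    (hv₁.sub hV₁c.continuousOn).norm.add (hv₂.sub hV₂c.continuousOn).norm
  refine le_exp_of_le_add_integral (u := u) hL ?_ (by positivity) huc fun ℓ hℓ => ?_
  · have := cumul_nonneg (μ := μ) hL
    have := intervalIntegral.integral_nonneg (μ := μ) hL (fun l _ => norm_nonneg (a l - a₀))
    positivity
  have hv₁i : IntervalIntegrable v₁ μ 0 ℓ := (hv₁.mono (hIcc hℓ)).intervalIntegrable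
  have hv₂i : IntervalIntegrable v₂ μ 0 ℓ := (hv₂.mono (hIcc hℓ)).intervalIntegrable
  have hV₁i : IntervalIntegrable V₁ μ 0 ℓ := hV₁c.intervalIntegrable _ _
  have hV₂i : IntervalIntegrable V₂ μ 0 ℓ := hV₂c.intervalIntegrable _ _
  have hd₁i : IntervalIntegrable (fun l => ‖v₁ l - V₁ l‖) μ 0 ℓ := (hv₁i.sub hV₁i).norm
  have hd₂i : IntervalIntegrable (fun l => ‖v₂ l - V₂ l‖) μ 0 ℓ := (hv₂i.sub hV₂i).norm
  have hm1 : ‖Complex.I * z - 1‖ ≤ ‖z‖ + 1 := (norm_sub_le _ _).trans (by simp)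
  have hp1 : ‖Complex.I * z + 1‖ ≤ ‖z‖ + 1 := (norm_add_le _ _).trans (by simp)
  have herr : IntervalIntegrable (fun l => ‖z‖ * ‖a l - a₀‖ + 1) μ 0 ℓ :=
    ((hdi hℓ.1).const_mul _).add intervalIntegrable_const
  have hb₁ : IntervalIntegrable (fun l => ‖z‖ * ‖v₁ l - V₁ l‖ + (‖z‖ + 1) * ‖v₂ l - V₂ l‖
      + (‖z‖ * ‖a l - a₀‖ + 1) * ‖V₂ l‖) μ 0 ℓ :=
    ((hd₁i.const_mul _).add (hd₂i.const_mul _)).add (herr.mul_continuousOn hV₂c.norm.continuousOn)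
  have hb₂ : IntervalIntegrable (fun l => ‖z‖ * ‖v₂ l - V₂ l‖ + (‖z‖ + 1) * ‖v₁ l - V₁ l‖
      + (‖z‖ * ‖a l - a₀‖ + 1) * ‖V₁ l‖) μ 0 ℓ :=
    ((hd₂i.const_mul _).add (hd₁i.const_mul _)).add (herr.mul_continuousOn hV₁c.norm.continuousOn)
  have hd₁ : ‖v₁ ℓ - V₁ ℓ‖ ≤ ∫ l in (0 : ℝ)..ℓ, (‖z‖ * ‖v₁ l - V₁ l‖ +
      (‖z‖ + 1) * ‖v₂ l - V₂ l‖ + (‖z‖ * ‖a l - a₀‖ + 1) * ‖V₂ l‖) ∂μ := by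
    have e : v₁ ℓ - V₁ ℓ = ∫ l in (0 : ℝ)..ℓ,
        ((-(Complex.I * z) * v₁ l + (Complex.I * z - 1) * (a l * v₂ l)) -
          Complex.I * (a₀ * V₂ l - V₁ l) * z) ∂μ := by
      rw [intervalIntegral.integral_sub, h₁ ℓ hℓ, hV₁]
      · simp only [integral_model₁ h hℓ.1]
        ring
      · exact (hv₁i.const_mul _).add
          (((hai hℓ.1).mul_continuousOn (hv₂.mono (hIcc hℓ))).const_mul _)
      · exact (Continuous.intervalIntegrable (by fun_prop) _ _)
    rw [e]
    refine intervalIntegral.norm_integral_le_of_norm_le hℓ.1 ?_ hb₁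
    filter_upwards [hab' (ℓ := ℓ)] with l hl hl'
    have hal := hl hl'
    -- The differences carry the full coefficients, so that `V₂` meets only `a l - a₀` (with a
    -- factor `z`) and the contribution of `B` (without one).
    have e2 : (-(Complex.I * z) * v₁ l + (Complex.I * z - 1) * (a l * v₂ l)) -
          Complex.I * (a₀ * V₂ l - V₁ l) * z =
        -(Complex.I * z) * (v₁ l - V₁ l) + (Complex.I * z - 1) * (a l) * (v₂ l - V₂ l) +
          (Complex.I * z * (a l - a₀) - a l) * V₂ l := by ring
    rw [e2]
    refine (norm_add₃_le).trans ?_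
    simp only [norm_mul, norm_neg, Complex.norm_I, one_mul]
    gcongr
    · exact (mul_le_mul hm1 hal (norm_nonneg _) (by positivity)).trans_eq (mul_one _)
    · refine (norm_sub_le _ _).trans ?_
      simp only [norm_mul, Complex.norm_I, one_mul]
      gcongr
  have hd₂ : ‖v₂ ℓ - V₂ ℓ‖ ≤ ∫ l in (0 : ℝ)..ℓ, (‖z‖ * ‖v₂ l - V₂ l‖ +
      (‖z‖ + 1) * ‖v₁ l - V₁ l‖ + (‖z‖ * ‖a l - a₀‖ + 1) * ‖V₁ l‖) ∂μ := by
    have e : v₂ ℓ - V₂ ℓ = ∫ l in (0 : ℝ)..ℓ,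
        ((Complex.I * z * v₂ l - (Complex.I * z + 1) * (star (a l) * v₁ l)) -
          Complex.I * (V₂ l - star a₀ * V₁ l) * z) ∂μ := by
      rw [intervalIntegral.integral_sub, h₂ ℓ hℓ, hV₂]
      · simp only [integral_model₂ h hℓ.1]
        ring
      · exact (hv₂i.const_mul _).sub
          (((hasi hℓ.1).mul_continuousOn (hv₁.mono (hIcc hℓ))).const_mul _)
      · exact (Continuous.intervalIntegrable (by fun_prop) _ _)
    rw [e]
    refine intervalIntegral.norm_integral_le_of_norm_le hℓ.1 ?_ hb₂
    filter_upwards [hab' (ℓ := ℓ)] with l hl hl'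
    have hal := hl hl'
    have e2 : (Complex.I * z * v₂ l - (Complex.I * z + 1) * (star (a l) * v₁ l)) -
          Complex.I * (V₂ l - star a₀ * V₁ l) * z =
        (Complex.I * z) * (v₂ l - V₂ l) + -((Complex.I * z + 1) * star (a l)) * (v₁ l - V₁ l) +
          -(Complex.I * z * star (a l - a₀) + star (a l)) * V₁ l := by
      rw [star_sub]; ring
    rw [e2]
    refine (norm_add₃_le).trans ?_
    simp only [norm_mul, norm_neg, Complex.norm_I, one_mul, norm_star]
    gcongr
    · exact (mul_le_mul hp1 hal (norm_nonneg _) (by positivity)).trans_eq (mul_one _)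
    · refine (norm_add_le _ _).trans ?_
      simp only [norm_mul, Complex.norm_I, one_mul, norm_star]
      gcongr
  have hui : IntervalIntegrable u μ 0 ℓ := hd₁i.add hd₂i
  calc u ℓ ≤ ∫ l in (0 : ℝ)..ℓ, ((‖z‖ * ‖v₁ l - V₁ l‖ +
        (‖z‖ + 1) * ‖v₂ l - V₂ l‖ + (‖z‖ * ‖a l - a₀‖ + 1) * ‖V₂ l‖) + (‖z‖ * ‖v₂ l - V₂ l‖ +
        (‖z‖ + 1) * ‖v₁ l - V₁ l‖ + (‖z‖ * ‖a l - a₀‖ + 1) * ‖V₁ l‖)) ∂μ := by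
        rw [intervalIntegral.integral_add hb₁ hb₂]
        exact add_le_add hd₁ hd₂
    _ ≤ ∫ l in (0 : ℝ)..ℓ, (S * (‖z‖ * ‖a l - a₀‖ + 1) + (2 * ‖z‖ + 1) * u l) ∂μ := by
        refine intervalIntegral.integral_mono_on hℓ.1 (hb₁.add hb₂)
          ((herr.const_mul _).add (hui.const_mul _)) fun l hl => ?_
        have h3 := hV l ⟨hl.1, hl.2.trans hℓ.2⟩
        have h4 : (‖z‖ * ‖a l - a₀‖ + 1) * (‖V₁ l‖ + ‖V₂ l‖) ≤ (‖z‖ * ‖a l - a₀‖ + 1) * S := by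
          gcongr
        simp only [hu]
        linarith
    _ = S * (‖z‖ * (∫ l in (0 : ℝ)..ℓ, ‖a l - a₀‖ ∂μ) + cumul μ ℓ) +
          (2 * ‖z‖ + 1) * ∫ l in (0 : ℝ)..ℓ, u l ∂μ := by
        rw [intervalIntegral.integral_add (herr.const_mul _) (hui.const_mul _),
          intervalIntegral.integral_const_mul, intervalIntegral.integral_const_mul,
          intervalIntegral.integral_add ((hdi hℓ.1).const_mul _) intervalIntegrable_const,
          intervalIntegral.integral_const_mul]
        rfl
    _ ≤ S * (‖z‖ * (∫ l in (0 : ℝ)..L, ‖a l - a₀‖ ∂μ) + cumul μ L) +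
          (2 * ‖z‖ + 1) * ∫ l in (0 : ℝ)..ℓ, u l ∂μ := by
        gcongr
        · exact intervalIntegral.integral_mono_interval le_rfl hℓ.1 hℓ.2
            (Eventually.of_forall fun l => norm_nonneg _) (hdi hL)
        · exact cumul_monotone hℓ.2

end Perturbation

/-! ### Weyl disks and rows of the transfer matrix -/

/-- With `(v₁, v₂) = (w, 1) T`, the form defining the disk is `‖v₂‖² - ‖v₁‖²`. -/
lemma norm_le_norm_of_mem_weylDisk {T : Matrix (Fin 2) (Fin 2) ℂ} {w : ℂ} (h : w ∈ weylDisk T) :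
    ‖w * T 0 0 + T 1 0‖ ≤ ‖w * T 0 1 + T 1 1‖ := by
  have key : (![w, 1] ᵥ* (T * jMat * Tᴴ)) ⬝ᵥ star ![w, 1] =
      (w * T 0 1 + T 1 1) * star (w * T 0 1 + T 1 1) -
        (w * T 0 0 + T 1 0) * star (w * T 0 0 + T 1 0) := by
    simp [Matrix.vecMul, dotProduct, Fin.sum_univ_two, Matrix.mul_apply, jMat]
    ring
  have hns : ∀ u : ℂ, u * star u = ((‖u‖ ^ 2 : ℝ) : ℂ) := fun u => by
    rw [Complex.star_def, Complex.mul_conj, Complex.normSq_eq_norm_sq]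
  have h' : 0 ≤ ((![w, 1] ᵥ* (T * jMat * Tᴴ)) ⬝ᵥ star ![w, 1]).re := h
  rw [key, hns, hns, ← Complex.ofReal_sub, Complex.ofReal_re] at h'
  exact le_of_sq_le_sq (by linarith) (norm_nonneg _)

section TransferMatrix

variable {μ : Measure ℝ} {a : ℝ → ℂ} {𝔄 : ℂ → ℝ → Matrix (Fin 2) (Fin 2) ℂ}

lemma IsTransferMatrix.apply_zero (h : IsTransferMatrix μ a 𝔄) (z : ℂ) (p : Fin 2) {ℓ : ℝ}
    (hℓ : 0 ≤ ℓ) :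
    IntervalIntegrable (fun l => -(Complex.I * z) * 𝔄 z l p 0 +
      (Complex.I * z - 1) * (a l * 𝔄 z l p 1)) μ 0 ℓ ∧
    𝔄 z ℓ p 0 = (1 : Matrix (Fin 2) (Fin 2) ℂ) p 0 + ∫ l in (0 : ℝ)..ℓ,
      (-(Complex.I * z) * 𝔄 z l p 0 + (Complex.I * z - 1) * (a l * 𝔄 z l p 1)) ∂μ := by
  obtain ⟨hi, he⟩ := h z ℓ hℓ p 0
  have e : (fun l => (𝔄 z l * ((Complex.I * z) • coeffA (a l) - coeffB (a l))) p 0) =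
      fun l => -(-(Complex.I * z) * 𝔄 z l p 0 + (Complex.I * z - 1) * (a l * 𝔄 z l p 1)) := by
    funext l
    simp [Matrix.mul_apply, Fin.sum_univ_two, coeffA, coeffB]
    ring
  rw [e] at hi he
  refine ⟨by simpa only [Pi.neg_def, neg_neg] using hi.neg, ?_⟩
  rw [intervalIntegral.integral_neg] at he
  have e1 : (𝔄 z ℓ * jMat) p 0 = -𝔄 z ℓ p 0 := by
    simp [Matrix.mul_apply, Fin.sum_univ_two, jMat]
  have e2 : ∀ p, jMat p 0 = -(1 : Matrix (Fin 2) (Fin 2) ℂ) p 0 := by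
    simp [Fin.forall_fin_two, jMat]
  rw [e1, e2] at he
  linear_combination -he

lemma IsTransferMatrix.apply_one (h : IsTransferMatrix μ a 𝔄) (z : ℂ) (p : Fin 2) {ℓ : ℝ}
    (hℓ : 0 ≤ ℓ) :
    IntervalIntegrable (fun l => Complex.I * z * 𝔄 z l p 1 -
      (Complex.I * z + 1) * (star (a l) * 𝔄 z l p 0)) μ 0 ℓ ∧
    𝔄 z ℓ p 1 = (1 : Matrix (Fin 2) (Fin 2) ℂ) p 1 + ∫ l in (0 : ℝ)..ℓ,
      (Complex.I * z * 𝔄 z l p 1 - (Complex.I * z + 1) * (star (a l) * 𝔄 z l p 0)) ∂μ := by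
  obtain ⟨hi, he⟩ := h z ℓ hℓ p 1
  have e : (fun l => (𝔄 z l * ((Complex.I * z) • coeffA (a l) - coeffB (a l))) p 1) =
      fun l => Complex.I * z * 𝔄 z l p 1 - (Complex.I * z + 1) * (star (a l) * 𝔄 z l p 0) := by
    funext l
    simp [Matrix.mul_apply, Fin.sum_univ_two, coeffA, coeffB]
    ring
  rw [e] at hi he
  refine ⟨hi, ?_⟩
  have e1 : (𝔄 z ℓ * jMat) p 1 = 𝔄 z ℓ p 1 := by
    simp [Matrix.mul_apply, Fin.sum_univ_two, jMat]
  have e2 : ∀ p, jMat p 1 = (1 : Matrix (Fin 2) (Fin 2) ℂ) p 1 := by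
    simp [Fin.forall_fin_two, jMat]
  rw [e1, e2] at he
  exact he

lemma IsTransferMatrix.continuousOn [NullSingletonClass μ] (h : IsTransferMatrix μ a 𝔄) (z : ℂ)
    {L : ℝ} (hL : 0 ≤ L) (p q : Fin 2) : ContinuousOn (fun l => 𝔄 z l p q) (Icc 0 L) := by
  have key : ∀ {F : ℝ → ℂ} {g : ℝ → ℂ} {c : ℂ}, IntervalIntegrable F μ 0 L →
      (∀ ℓ, 0 ≤ ℓ → g ℓ = c + ∫ l in (0 : ℝ)..ℓ, F l ∂μ) → ContinuousOn g (Icc 0 L) := by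
    intro F g c hF hg
    have h1 : ContinuousOn (fun ℓ => c + ∫ l in (0 : ℝ)..ℓ, F l ∂μ) (Icc 0 L) := by
      refine continuousOn_const.add ?_
      have := intervalIntegral.continuousOn_primitive_interval (μ := μ) (f := F) (a := 0) (b := L)
        (by rwa [uIcc_of_le hL, ← intervalIntegrable_iff_integrableOn_Icc_of_le hL])
      rwa [uIcc_of_le hL] at this
    exact h1.congr fun ℓ hℓ => hg ℓ hℓ.1
  fin_cases q
  · exact key (h.apply_zero z p hL).1 fun ℓ hℓ => (h.apply_zero z p hℓ).2
  · exact key (h.apply_one z p hL).1 fun ℓ hℓ => (h.apply_one z p hℓ).2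

lemma IsTransferMatrix.row_zero (h : IsTransferMatrix μ a 𝔄) (z w : ℂ) {ℓ : ℝ} (hℓ : 0 ≤ ℓ) :
    w * 𝔄 z ℓ 0 0 + 𝔄 z ℓ 1 0 = w + ∫ l in (0 : ℝ)..ℓ,
      (-(Complex.I * z) * (w * 𝔄 z l 0 0 + 𝔄 z l 1 0) +
        (Complex.I * z - 1) * (a l * (w * 𝔄 z l 0 1 + 𝔄 z l 1 1))) ∂μ := by
  obtain ⟨i0, e0⟩ := h.apply_zero z 0 hℓ
  obtain ⟨i1, e1⟩ := h.apply_zero z 1 hℓ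
  rw [e0, e1, mul_add, ← intervalIntegral.integral_const_mul, add_add_add_comm,
    ← intervalIntegral.integral_add (i0.const_mul w) i1]
  congr 1
  · simp
  · congr 1
    funext l
    ring

lemma IsTransferMatrix.row_one (h : IsTransferMatrix μ a 𝔄) (z w : ℂ) {ℓ : ℝ} (hℓ : 0 ≤ ℓ) :
    w * 𝔄 z ℓ 0 1 + 𝔄 z ℓ 1 1 = 1 + ∫ l in (0 : ℝ)..ℓ,
      (Complex.I * z * (w * 𝔄 z l 0 1 + 𝔄 z l 1 1) -
        (Complex.I * z + 1) * (star (a l) * (w * 𝔄 z l 0 0 + 𝔄 z l 1 0))) ∂μ := by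
  obtain ⟨i0, e0⟩ := h.apply_one z 0 hℓ
  obtain ⟨i1, e1⟩ := h.apply_one z 1 hℓ
  rw [e0, e1, mul_add, ← intervalIntegral.integral_const_mul, add_add_add_comm,
    ← intervalIntegral.integral_add (i0.const_mul w) i1]
  congr 1
  · simp
  · congr 1
    funext l
    ring

/-- The transfer matrix is the identity at `ℓ = 0`, where the Weyl disk is the unit disk; only `ℓ >
0` is given, so the inequality is carried to `0` by continuity. -/
lemma norm_schur_le_one [NullSingletonClass μ] (h : IsTransferMatrix μ a 𝔄) {z w : ℂ}
    (hw : ∀ ℓ > 0, w ∈ weylDisk (𝔄 z ℓ)) : ‖w‖ ≤ 1 := by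
  have hc := h.continuousOn z zero_le_one
  have h1 : ContinuousOn (fun ℓ => ‖w * 𝔄 z ℓ 0 0 + 𝔄 z ℓ 1 0‖) (Icc 0 1) :=
    ((continuousOn_const.mul (hc 0 0)).add (hc 1 0)).norm
  have h2 : ContinuousOn (fun ℓ => ‖w * 𝔄 z ℓ 0 1 + 𝔄 z ℓ 1 1‖) (Icc 0 1) :=
    ((continuousOn_const.mul (hc 0 1)).add (hc 1 1)).norm
  have h0 : (0 : ℝ) ∈ Icc (0 : ℝ) 1 := ⟨le_rfl, zero_le_one⟩
  have := ContinuousWithinAt.closure_le (s := Ioc (0 : ℝ) 1) (x := 0)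
    (by rw [closure_Ioc zero_ne_one]; exact h0)
    ((h1 0 h0).mono Ioc_subset_Icc_self) ((h2 0 h0).mono Ioc_subset_Icc_self)
    fun y hy => norm_le_norm_of_mem_weylDisk (hw y hy.1)
  rw [h.row_zero z w le_rfl, h.row_one z w le_rfl] at this
  simpa using this

end TransferMatrix

/-- Averages of `‖a l - a₀‖` are at least `‖a₀‖ - 1`. This makes the square root in the limit
genuine. -/
lemma norm_le_one_of_tendsto_average {μ : Measure ℝ} [IsLocallyFiniteMeasure μ]
    [NullSingletonClass μ] {a : ℝ → ℂ} (ham : AEStronglyMeasurable a (μ.restrict (Ici 0)))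
    (hab : ∀ᵐ l ∂(μ.restrict (Ici 0)), ‖a l‖ ≤ 1) (hpos : ∀ ℓ : ℝ, 0 < ℓ → 0 < cumul μ ℓ) {a₀ : ℂ}
    (hLeb : Tendsto (fun ℓ : ℝ => (cumul μ ℓ)⁻¹ * ∫ l in (0 : ℝ)..ℓ, ‖a l - a₀‖ ∂μ)
      (𝓝[>] 0) (𝓝 0)) : ‖a₀‖ ≤ 1 := by
  have : ‖a₀‖ - 1 ≤ 0 := by
    refine ge_of_tendsto hLeb ?_
    filter_upwards [self_mem_nhdsWithin] with ℓ hℓ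
    have hℓ' : 0 < ℓ := hℓ
    rw [inv_mul_eq_div, le_div_iff₀ (hpos ℓ hℓ'), cumul, ← intervalIntegral.integral_const_mul]
    have hsub : Icc 0 ℓ ⊆ Ici (0 : ℝ) := fun x hx => hx.1
    refine intervalIntegral.integral_mono_ae_restrict hℓ'.le intervalIntegrable_const
      ((intervalIntegrable_of_ae_norm_le ham hab hℓ'.le).sub intervalIntegrable_const).norm ?_
    filter_upwards [ae_restrict_of_ae_restrict_of_subset hsub hab] with l hl
    have := norm_sub_norm_le a₀ (a l)
    rw [norm_sub_rev] at this
    simp only [mul_one]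
    linarith
  linarith

end ArovGauge

/-! ### The limit in the sector -/

open ArovGauge in
theorem theorem4p1 (μ : Measure ℝ) (a : ℝ → ℂ)
    (hparam : ArovGauge.IsParameters μ a)
    (hpos : ∀ ℓ : ℝ, 0 < ℓ → 0 < μ (Ico 0 ℓ))
    (𝔄 : ℂ → ℝ → Matrix (Fin 2) (Fin 2) ℂ)
    (h𝔄 : ArovGauge.IsTransferMatrix μ a 𝔄)
    (s : ℂ → ℂ) (hs : ArovGauge.IsSchurFunction 𝔄 s)
    (a₀ : ℂ)
    (hLeb : Tendsto (fun ℓ : ℝ => (μ.real (Ico 0 ℓ))⁻¹ * ∫ l in (0 : ℝ)..ℓ, ‖a l - a₀‖ ∂μ)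
      (𝓝[>] 0) (𝓝 0))
    (δ : ℝ) (hδ : 0 < δ) :
    Tendsto s (Bornology.cobounded ℂ ⊓ 𝓟 {z : ℂ | z.arg ∈ Icc δ (Real.pi - δ)})
      (𝓝 (a₀ / (1 + (Real.sqrt (1 - ‖a₀‖ ^ 2) : ℂ)))) := by
  have : NullSingletonClass μ := ⟨hparam.no_atoms⟩
  have : IsFiniteMeasureOnCompacts μ := ⟨fun K hK => hparam.finite_on_compacts K hK⟩
  have hcum : ∀ ℓ : ℝ, 0 < ℓ → 0 < cumul μ ℓ := fun ℓ hℓ => by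
    rw [cumul_eq_real_Ico hℓ.le]
    refine ENNReal.toReal_pos (hpos ℓ hℓ).ne' ?_
    exact ((measure_mono Ico_subset_Icc_self).trans_lt measure_Icc_lt_top).ne
  have hLeb' : Tendsto (fun ℓ : ℝ => (cumul μ ℓ)⁻¹ * ∫ l in (0 : ℝ)..ℓ, ‖a l - a₀‖ ∂μ)
      (𝓝[>] 0) (𝓝 0) := by
    refine hLeb.congr' ?_
    filter_upwards [self_mem_nhdsWithin] with ℓ hℓ
    rw [cumul_eq_real_Ico (le_of_lt hℓ)]
  have ha₀ := norm_le_one_of_tendsto_average hparam.measurable hparam.norm_le_one hcum hLeb'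
  have h0 : 0 ≤ 1 - ‖a₀‖ ^ 2 := by nlinarith [norm_nonneg a₀]
  have hκ : ((Real.sqrt (1 - ‖a₀‖ ^ 2) : ℝ) : ℂ) ^ 2 = 1 - a₀ * star a₀ := by
    rw [Complex.star_def, Complex.mul_conj, Complex.normSq_eq_norm_sq]
    exact_mod_cast Real.sq_sqrt h0
  rcases lt_or_ge (Real.pi - δ) δ with hδπ | hδπ
  · simp [Icc_eq_empty_of_lt hδπ]
  have hsin : 0 < Real.sin δ := Real.sin_pos_of_pos_of_lt_pi hδ (by linarith)
  rw [Metric.tendsto_nhds]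
  intro ε hε
  obtain ⟨C, hC0, ε', hε', hweyl⟩ := exists_model_weyl ha₀ hsin hε
  set κ : ℂ := ((Real.sqrt (1 - ‖a₀‖ ^ 2) : ℝ) : ℂ) with hκdef
  obtain ⟨S, hS0, hS⟩ := exists_model_bound κ a₀ C
  -- The Grönwall error will be at most `2 * η * D`: the averaging error and `cumul μ L` each
  -- contribute `η * C`, and `6 * C` bounds the exponent once `‖z‖ ≥ 1`. Using `D + 1` in `η` avoids
  -- dividing by zero.
  set D := 2 * S * C * Real.exp (6 * C) with hD
  have hD0 : 0 ≤ D := by positivity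
  set η := ε' / (2 * (D + 1)) with hη
  have hη0 : 0 < η := by positivity
  obtain ⟨ℓ₀, hℓ₀, hav⟩ := (mem_nhdsGT_iff_exists_Ioc_subset).1
    (hLeb'.eventually_lt_const hη0)
  have hℓ₀' : 0 < ℓ₀ := hℓ₀
  rw [eventually_inf_principal]
  filter_upwards [tendsto_norm_cobounded_atTop.eventually_ge_atTop 1,
    tendsto_norm_cobounded_atTop.eventually_ge_atTop (C / cumul μ ℓ₀),
    tendsto_norm_cobounded_atTop.eventually_ge_atTop (1 / η)] with z hz1 hz2 hz3 hzarg
  have hz0 : 0 < ‖z‖ := by linarith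
  have him : Real.sin δ * ‖z‖ ≤ z.im := by
    have h1 : z.im = ‖z‖ * Real.sin z.arg := by
      rw [Complex.norm_mul_sin_arg]
    rw [h1, mul_comm]
    gcongr
    rcases le_total z.arg (Real.pi / 2) with h | h
    · exact Real.sin_le_sin_of_le_of_le_pi_div_two (by linarith) h hzarg.1
    · rw [← Real.sin_pi_sub z.arg]
      exact Real.sin_le_sin_of_le_of_le_pi_div_two (by linarith) (by linarith)
        (by linarith [hzarg.2])
  have himpos : 0 < z.im := lt_of_lt_of_le (by positivity) him
  -- The blow-up scale; `L ≤ ℓ₀` keeps it in the range where the averages are below `η`.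
  obtain ⟨L, ⟨hL0, hLℓ⟩, hLC⟩ := intermediate_value_Icc hℓ₀'.le
    (continuous_cumul (μ := μ)).continuousOn (show C / ‖z‖ ∈ Icc (cumul μ 0) (cumul μ ℓ₀) from
      ⟨by rw [cumul_zero]; positivity, by
        rw [div_le_iff₀ (hcum _ hℓ₀')] at hz2
        rw [div_le_iff₀ hz0]
        linarith⟩)
  have hLpos : 0 < L := by
    refine hL0.lt_of_ne fun h => ?_
    rw [← h, cumul_zero] at hLC
    have : 0 < C / ‖z‖ := by positivity
    linarith
  have hzL : ‖z‖ * cumul μ L = C := by rw [hLC]; field_simp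
  have hmem : ∀ ℓ > 0, s z ∈ weylDisk (𝔄 z ℓ) := fun ℓ hℓ => by
    have h1 : s z ∈ ⋂ ℓ ∈ Ioi (0 : ℝ), weylDisk (𝔄 z ℓ) := by rw [hs z himpos]; rfl
    exact mem_iInter₂.1 h1 ℓ hℓ
  set w := s z with hw
  have hw1 : ‖w‖ ≤ 1 := norm_schur_le_one h𝔄 hmem
  have hnorm : ∀ l ∈ Icc 0 L, ‖z * (cumul μ l : ℂ)‖ ≤ C := fun l hl => by
    rw [norm_mul, Complex.norm_real, Real.norm_of_nonneg (cumul_nonneg hl.1), ← hzL]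
    gcongr
    exact cumul_monotone hl.2
  have hc := h𝔄.continuousOn z hL0
  have hcmp := norm_sub_model_le (κ := κ) (a₀ := a₀) (z := z) (w := w) hparam.measurable
    hparam.norm_le_one hκ hL0
    (v₁ := fun l => w * 𝔄 z l 0 0 + 𝔄 z l 1 0) (v₂ := fun l => w * 𝔄 z l 0 1 + 𝔄 z l 1 1)
    ((continuousOn_const.mul (hc 0 0)).add (hc 1 0))
    ((continuousOn_const.mul (hc 0 1)).add (hc 1 1))
    (fun ℓ hℓ => h𝔄.row_zero z w hℓ.1) (fun ℓ hℓ => h𝔄.row_one z w hℓ.1) hS0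
    (fun l hl => hS w _ hw1 (hnorm l hl))
  have hint : ∫ l in (0 : ℝ)..L, ‖a l - a₀‖ ∂μ ≤ η * cumul μ L := by
    have h1 : (cumul μ L)⁻¹ * ∫ l in (0 : ℝ)..L, ‖a l - a₀‖ ∂μ < η := hav ⟨hLpos, hLℓ⟩
    rw [inv_mul_eq_div, div_lt_iff₀ (hcum L hLpos)] at h1
    exact h1.le
  have hsmall : cumul μ L ≤ η * C := by
    rw [hLC, div_le_iff₀ hz0]
    rw [div_le_iff₀ hη0] at hz3
    nlinarith
  have hbound : 2 * (S * (‖z‖ * (∫ l in (0 : ℝ)..L, ‖a l - a₀‖ ∂μ) + cumul μ L)) *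
        Real.exp (2 * (2 * ‖z‖ + 1) * cumul μ L) ≤ ε' := by
    have hcL := hcum L hLpos
    calc _ ≤ 2 * (S * (‖z‖ * (η * cumul μ L) + η * C)) * Real.exp (6 * C) := by
          have h6 : 2 * (2 * ‖z‖ + 1) * cumul μ L ≤ 6 * C := by nlinarith
          gcongr 2 * (S * (‖z‖ * ?_ + ?_)) * Real.exp ?_
      _ = D * (2 * η) := by rw [hD, ← hzL]; ring
      _ ≤ (D + 1) * (2 * η) := by gcongr; linarith
      _ = ε' := by rw [hη]; field_simp
  have hW := norm_le_norm_of_mem_weylDisk (hmem L hLpos)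
  rw [dist_eq_norm]
  refine hweyl w (z * (cumul μ L : ℂ)) hw1 (hnorm L ⟨hL0, le_rfl⟩) ?_ ?_
  · rw [Complex.im_mul_ofReal, ← hzL, ← mul_assoc]
    gcongr
    exact (hcum L hLpos).le
  · have t1 := norm_sub_norm_le (model₁ κ a₀ w (z * cumul μ L)) (w * 𝔄 z L 0 0 + 𝔄 z L 1 0)
    have t2 := norm_sub_norm_le (w * 𝔄 z L 0 1 + 𝔄 z L 1 1) (model₂ κ a₀ w (z * cumul μ L))
    rw [norm_sub_rev] at t1
    linarith
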